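/- Let $q\ge 7$ be a prime power, and let $a,b,c,u,v\in\mathbb F_{q^2}$ satisfy $a^{q+1}=b^{q+1}$ and $av\neq bu$. For $r\in\mathbb N$ put $$f_r(x)=(ax^q+bx+c)^r+ux^q+vx\in\mathbb F_{q^2}[x].$$ For an integer $1\le m\le q^2$, a polynomial $f$ is called $m$-to-$1$ on $\mathbb F_{q^2}$ if there are $\lfloor q^2/m\rfloor$ distinct elements of $\mathbb F_{q^2}$ each of which has exactly $m$ preimages under $x\mapsto f(x)$ on $\mathbb F_{q^2}$. Let $$A=bu-av,\quad B=au^q-bv^q,\quad \beta=3(a^qc-bc^q),\quad \gamma=v^{q+1}-u^{q+1},$$ and let $1\le m\le q$. Given $\alpha,\delta\in\mathbb F_{q^2}$, consider the following cases: 1. $m=1$, $\alpha=0$, $\beta=0$, and $\gamma\ne0$; 2. $m=1$, $2\mid q$, $\alpha=0$, $\beta\neq0$, and $\delta=0$; 3. $m=1$, $3\mid q$, $\alpha\neq0$, and $(\alpha\gamma)^{(q-1)/2}\neq ab^{-1}$; 4. $m=1$, $q\equiv2\pmod 3$, $\alpha\neq0$, and $\beta^2B^{q+1}=3\alpha\gamma$;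 5. $m=2$, $2\mid q$, $\alpha=0$, $\beta\neq0$, and $\delta\neq0$; 6. $m=3$, $3\mid q$, $\alpha\neq0$, and $(\alpha\gamma)^{(q-1)/2}=ab^{-1}$; 7. $m=q$, $\alpha=0$, $\beta=0$, and $\gamma=0$. Theorem. (i) ($r=3$) With $\alpha=a^{2q}B^q+b^2B$ and $\delta=\beta^2B-a^{2q}\gamma$, the polynomial $f_3$ is $m$-to-$1$ on $\mathbb F_{q^2}$ if and only if one of the cases 1--7 holds. (ii) ($r=3q$) With $\alpha=a^{2q}A^q+b^2A$ and $\delta=\beta^2A-a^{2q}\gamma$, the polynomial $f_{3q}$ is $m$-to-$1$ on $\mathbb F_{q^2}$ if and only if one of the cases 1--7 holds. (In case 4 it makes no difference whether one writes $B^{q+1}$ or $A^{q+1}$, since $A^{q+1}=B^{q+1}$.) -/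

import Mathlib

/-- A map `f` from a finite type `S` (of cardinality `k * m + r` with `0 ≤ r < m`) is `m`-to-1
if `1 ≤ m ≤ #S` and there are `k = #S / m` distinct elements of the codomain, each of which has
exactly `m` preimages under `f`. -/
def IsManyToOne {S T : Type*} (m : ℕ) (f : S → T) : Prop :=
  1 ≤ m ∧ m ≤ Nat.card S ∧
    ∃ Y : Finset T, Y.card = Nat.card S / m ∧ ∀ y ∈ Y, (f ⁻¹' {y}).ncard = m

/-- A polynomial over a (finite) field is `m`-to-1 if its evaluation map is. -/
def IsManyToOnePoly {F : Type*} [Field F] (m : ℕ) (p : Polynomial F) : Prop :=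
  IsManyToOne m (fun x : F => p.eval x)

/-- The polynomial `(a x ^ q + b x + c) ^ r + u x ^ q + v x`. -/
noncomputable def fPoly {F : Type*} [Field F] (q r : ℕ) (a b c u v : F) : Polynomial F :=
  (Polynomial.C a * Polynomial.X ^ q + Polynomial.C b * Polynomial.X + Polynomial.C c) ^ r
    + Polynomial.C u * Polynomial.X ^ q + Polynomial.C v * Polynomial.X

/-- The disjunction of the seven cases of the classification. -/
def SevenCases {F : Type*} [Field F] (q m : ℕ) (a b B α β γ δ : F) : Prop :=
  (m = 1 ∧ α = 0 ∧ β = 0 ∧ γ ≠ 0) ∨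
  (m = 1 ∧ 2 ∣ q ∧ α = 0 ∧ β ≠ 0 ∧ δ = 0) ∨
  (m = 1 ∧ 3 ∣ q ∧ α ≠ 0 ∧ (α * γ) ^ ((q - 1) / 2) ≠ a * b⁻¹) ∨
  (m = 1 ∧ q ≡ 2 [MOD 3] ∧ α ≠ 0 ∧ β ^ 2 * B ^ (q + 1) = 3 * α * γ) ∨
  (m = 2 ∧ 2 ∣ q ∧ α = 0 ∧ β ≠ 0 ∧ δ ≠ 0) ∨
  (m = 3 ∧ 3 ∣ q ∧ α ≠ 0 ∧ (α * γ) ^ ((q - 1) / 2) = a * b⁻¹) ∨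
  (m = q ∧ α = 0 ∧ β = 0 ∧ γ = 0)

/-! Write `σ` for `x ↦ x ^ q` and `Λ x = a σ x + b x`. Equality of the norms of `a` and `b` gives `σ
(Λ x) = (σ a / b) Λ x`, so `Λ` takes values on one line `w K`, where `K` is the fixed field of `σ`.
Since `b u - a v ≠ 0`, the equation `f x = y` recovers `x` from `y` and `Λ x`. Solving it thus
amounts to solving for `s = Λ x / w` in `K`, and this condition reads `g s = φ y`, with `g` a cubic
over `K` and `φ` a map to `K` with all fibers of size `q` (`exists_cubic_isManyToOne_iff`). For `m ≤
q` a count leaves no room for exceptional values, so `f` is `m`-to-1 iff every nonempty fiber of `g`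
has size `m` (`isManyToOne_iff_uniformFibers`). Such cubics are classified by degree and
characteristic, and their coefficients are then expressed by `α, β, γ, δ`
(`isManyToOne_iff_sevenCases`). Applying `σ` to `f` turns exponent `3 * q` into exponent `3`, with
`σ v, σ u` in place of `u, v`. -/

/-- All nonempty fibers of `g` have exactly `m` elements. -/
def UniformFibers {S T : Type*} (m : ℕ) (g : S → T) : Prop :=
  ∀ s, ({t | g t = g s} : Set S).ncard = m

/-! ### Maps whose nonempty fibers all have the same size. -/

section UniformFibers

variable {S T : Type*}

theorem uniformFibers_one_iff [Finite S] {g : S → T} :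
    UniformFibers 1 g ↔ Function.Injective g := by
  constructor
  · intro h s t hst
    exact ((Set.ncard_le_one (Set.toFinite _)).1 (h s).le s rfl t hst.symm)
  · intro h s
    rw [Set.ncard_eq_one]
    exact ⟨s, by ext t; simp [h.eq_iff]⟩

theorem UniformFibers.eq [Nonempty S] {m n : ℕ} {g : S → T} (hm : UniformFibers m g)
    (hn : UniformFibers n g) : m = n :=
  (hm (Classical.arbitrary S)).symm.trans (hn (Classical.arbitrary S))

theorem UniformFibers.iff_eq [Nonempty S] {m n : ℕ} {g : S → T} (hm : UniformFibers m g) :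
    UniformFibers n g ↔ n = m :=
  ⟨fun h => h.eq hm, fun h => h ▸ hm⟩

theorem UniformFibers.dvd_card [Finite S] {m : ℕ} {g : S → T} (h : UniformFibers m g) :
    m ∣ Nat.card S := by
  classical
  have := Fintype.ofFinite S
  rw [Nat.card_eq_fintype_card, ← Finset.card_univ,
    Finset.card_eq_sum_card_fiberwise (f := g) (t := Finset.univ.image g) (by intro; simp)]
  refine Finset.dvd_sum fun b hb => ?_
  obtain ⟨s, -, rfl⟩ := Finset.mem_image.1 hb
  rw [← h s, ← Set.ncard_coe_finset]
  simp

theorem uniformFibers_comp_iff {S' T' : Type*} {m : ℕ} {g : S → T} (e : S' ≃ S) {j : T → T'}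
    (hj : Function.Injective j) :
    UniformFibers m (fun s => j (g (e s))) ↔ UniformFibers m g := by
  have key : ∀ s, ({t | j (g (e t)) = j (g (e s))} : Set S').ncard =
      ({t | g t = g (e s)} : Set S).ncard := by
    intro s
    rw [← Set.ncard_preimage_of_injective_subset_range (s := {t | g t = g (e s)}) e.injective
      (by simp)]
    congr 1
    ext t
    simp [hj.eq_iff]
  constructor
  · intro h s
    have := h (e.symm s)
    rwa [key, e.apply_symm_apply] at this
  · intro h s
    rw [key]
    exact h _

end UniformFibers

theorem Polynomial.ncard_eval_eq_zero_le {K : Type*} [Field K] {p : Polynomial K} (hp : p ≠ 0) :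
    ({x | p.eval x = 0} : Set K).ncard ≤ p.natDegree := by
  classical
  have : ({x | p.eval x = 0} : Set K) = p.roots.toFinset := by
    ext x
    simp [hp]
  rw [this, Set.ncard_coe_finset]
  exact (Multiset.toFinset_card_le _).trans p.card_roots'

theorem natCast_prime_eq_zero_iff {K : Type*} [Field K] [Finite K] {ℓ : ℕ} (hℓ : ℓ.Prime) :
    (ℓ : K) = 0 ↔ ℓ ∣ Nat.card K := by
  have := Fintype.ofFinite K
  obtain ⟨p, hp, n, hpp, hn⟩ := FiniteField.card' K
  rw [Nat.card_eq_fintype_card, hn, CharP.cast_eq_zero_iff K p ℓ]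
  constructor
  · intro h
    rw [(Nat.prime_dvd_prime_iff_eq hpp hℓ).1 h]
    exact dvd_pow_self _ n.ne_zero
  · intro h
    rw [(Nat.prime_dvd_prime_iff_eq hℓ hpp).1 (hℓ.dvd_of_dvd_pow h)]

/-! ### Polynomials of degree at most 3 over a finite field with uniform fibers. -/

section Cubic

variable {K : Type*} [Field K] [Finite K]

theorem uniformFibers_linear_iff {m : ℕ} {k : K} (hk : k ≠ 0) :
    UniformFibers m (fun s : K => k * s) ↔ m = 1 :=
  UniformFibers.iff_eq (uniformFibers_one_iff.2 (mul_right_injective₀ hk))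

theorem uniformFibers_const_iff {K : Type*} [Field K] {m : ℕ} (k : K) :
    UniformFibers m (fun _ : K => k) ↔ m = Nat.card K :=
  UniformFibers.iff_eq fun s => by simp [Set.ncard_univ]

/-- The vertex `-l / (2 * k)` is alone in its fiber, while points symmetric about it share a value.
-/
theorem not_uniformFibers_quadratic {m : ℕ} (h2 : (2 : K) ≠ 0) {k l : K} (hk : k ≠ 0) :
    ¬ UniformFibers m (fun s : K => k * s ^ 2 + l * s) := by
  intro h
  have key : ∀ s t : K, k * t ^ 2 + l * t = k * s ^ 2 + l * s ↔ t = s ∨ t = -l / k - s := by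
    intro s t
    have hfac : k * t ^ 2 + l * t - (k * s ^ 2 + l * s) = k * ((t - s) * (t - (-l / k - s))) := by
      field_simp
      ring
    rw [← sub_eq_zero, hfac]
    simp [hk, sub_eq_zero]
  have h1 : m = 1 := by
    rw [← h (-l / (2 * k)), Set.ncard_eq_one]
    refine ⟨-l / (2 * k), ?_⟩
    ext t
    simp only [Set.mem_ofPred_eq, key, Set.mem_singleton_iff]
    have : -l / k - -l / (2 * k) = -l / (2 * k) := by
      field_simp
      ring
    rw [this, or_self]
  have hinj := uniformFibers_one_iff.1 (h1 ▸ h)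
  have h3 : (-l / (2 * k) + 1 : K) = -l / (2 * k) - 1 := by
    apply hinj
    rw [key]
    right
    field_simp
    ring
  apply h2
  linear_combination h3

theorem injective_sq_of_two_eq_zero {K : Type*} [Field K] (h2 : (2 : K) = 0) :
    Function.Injective (fun s : K => s ^ 2) := by
  intro s t hst
  have : (s - t) ^ 2 = 0 := by
    linear_combination hst + (t ^ 2 - s * t) * h2
  exact sub_eq_zero.1 (pow_eq_zero_iff two_ne_zero |>.1 this)

theorem uniformFibers_quadratic_even_zero_iff {m : ℕ} (h2 : (2 : K) = 0) {k : K} (hk : k ≠ 0) :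
    UniformFibers m (fun s : K => k * s ^ 2) ↔ m = 1 :=
  UniformFibers.iff_eq (uniformFibers_one_iff.2
    ((mul_right_injective₀ hk).comp (injective_sq_of_two_eq_zero h2)))

theorem uniformFibers_quadratic_even_iff {K : Type*} [Field K] {m : ℕ} (h2 : (2 : K) = 0) {k l : K} (hk : k ≠ 0)
    (hl : l ≠ 0) : UniformFibers m (fun s : K => k * s ^ 2 + l * s) ↔ m = 2 := by
  refine UniformFibers.iff_eq fun s => ?_
  rw [Set.ncard_eq_two]
  refine ⟨s, -l / k - s, ?_, ?_⟩
  · intro h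
    apply hl
    have : l / k = 0 := by linear_combination h - s * h2
    simpa [hk] using this
  · ext t
    simp only [Set.mem_ofPred_eq, Set.mem_insert_iff, Set.mem_singleton_iff]
    have hfac : k * t ^ 2 + l * t - (k * s ^ 2 + l * s) = k * ((t - s) * (t - (-l / k - s))) := by
      field_simp
      ring
    rw [← sub_eq_zero, hfac]
    simp [hk, sub_eq_zero]

/-- In characteristic 3 the cubic is additive, so its fibers are cosets of its kernel: here the
kernel is trivial, in the next lemma it is `{0, r, -r}`. -/
theorem uniformFibers_additive_cubic_iff_one {m : ℕ} (h3 : (3 : K) = 0) {k l : K}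
    (hr : ¬ ∃ r : K, r ≠ 0 ∧ k * r ^ 2 + l = 0) :
    UniformFibers m (fun s : K => k * s ^ 3 + l * s) ↔ m = 1 := by
  refine UniformFibers.iff_eq (uniformFibers_one_iff.2 fun s t hst => ?_)
  by_contra hne
  refine hr ⟨s - t, sub_ne_zero.2 hne, mul_left_cancel₀ (sub_ne_zero.2 hne) ?_⟩
  linear_combination hst - k * (s ^ 2 * t - s * t ^ 2) * h3

theorem uniformFibers_additive_cubic_iff_three {K : Type*} [Field K] {m : ℕ} (h3 : (3 : K) = 0) {k l : K} (hk : k ≠ 0)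
    (hr : ∃ r : K, r ≠ 0 ∧ k * r ^ 2 + l = 0) :
    UniformFibers m (fun s : K => k * s ^ 3 + l * s) ↔ m = 3 := by
  obtain ⟨r, hr0, hr⟩ := hr
  refine UniformFibers.iff_eq fun s => ?_
  rw [Set.ncard_eq_three]
  refine ⟨s, s + r, s - r, by simpa using hr0, ?_, ?_, ?_⟩
  · intro h
    exact hr0 (by linear_combination h)
  · intro h
    exact hr0 (by linear_combination -h + r * h3)
  · ext t
    simp only [Set.mem_ofPred_eq, Set.mem_insert_iff, Set.mem_singleton_iff]
    have hfac : k * t ^ 3 + l * t - (k * s ^ 3 + l * s) =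
        k * ((t - s) * ((t - (s + r)) * (t - (s - r)))) := by
      linear_combination (t - s) * hr + k * (s * t ^ 2 - s ^ 2 * t) * h3
    rw [← sub_eq_zero, hfac]
    simp [hk, sub_eq_zero]

/-- The fiber of `0` is a single point, which forces injectivity; cubing is injective iff 3 does not
divide the order of the unit group. -/
theorem uniformFibers_cube_iff {m : ℕ} (h3 : (3 : K) ≠ 0) :
    UniformFibers m (fun s : K => s ^ 3) ↔ m = 1 ∧ Nat.card K ≡ 2 [MOD 3] := by
  classical
  have := Fintype.ofFinite K
  have h3' : ¬ 3 ∣ Nat.card K := by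
    rw [← natCast_prime_eq_zero_iff Nat.prime_three]
    exact_mod_cast h3
  have hu : Nat.card Kˣ = Nat.card K - 1 := by
    rw [Nat.card_units]
  have hpos : 0 < Nat.card K := Nat.card_pos
  constructor
  · intro h
    have h1 : m = 1 := by
      rw [← h 0, Set.ncard_eq_one]
      exact ⟨0, by ext; simp⟩
    refine ⟨h1, ?_⟩
    by_contra hmod
    have hdvd : 3 ∣ Fintype.card Kˣ := by
      rw [← Nat.card_eq_fintype_card, hu]
      unfold Nat.ModEq at hmod
      omega
    have := Fact.mk Nat.prime_three
    obtain ⟨x, hx⟩ := exists_prime_orderOf_dvd_card 3 hdvd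
    have hx3 : x ^ 3 = 1 := hx ▸ pow_orderOf_eq_one x
    have hinj : Function.Injective (fun s : K => s ^ 3) := by
      rw [← uniformFibers_one_iff, ← h1]
      exact h
    have hx1 : (x : K) = 1 := hinj (by
      simp only
      rw [← Units.val_pow_eq_pow_val, hx3]
      simp)
    rw [Units.val_eq_one.1 hx1, orderOf_one] at hx
    omega
  · rintro ⟨rfl, hmod⟩
    rw [uniformFibers_one_iff]
    have hcop : (Nat.card Kˣ).Coprime 3 := by
      rw [Nat.coprime_comm, Nat.Prime.coprime_iff_not_dvd Nat.prime_three, hu]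
      unfold Nat.ModEq at hmod
      omega
    intro s t hst
    simp only at hst
    by_cases hs : s = 0
    · subst hs
      exact (pow_eq_zero_iff three_ne_zero).1 (by simpa using hst.symm) |>.symm
    have ht : t ≠ 0 := by
      rintro rfl
      exact hs (by simpa using hst)
    have : Units.mk0 s hs = Units.mk0 t ht := (powCoprime hcop).injective (by
      ext
      simpa using hst)
    simpa using congrArg Units.val this

theorem exists_sq_add_mul_add_sq_add_eq_zero (h2 : (2 : K) ≠ 0) (e : K) (h3 : (3 : K) ≠ 0) :
    ∃ s t : K, s ^ 2 + s * t + t ^ 2 + e = 0 := by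
  have := Fintype.ofFinite K
  have hodd : Fintype.card K % 2 = 1 := by
    have := (natCast_prime_eq_zero_iff (K := K) Nat.prime_two).not.1 (by exact_mod_cast h2)
    rw [Nat.card_eq_fintype_card] at this
    omega
  -- Four times the form is `(2 * s + t) ^ 2 + 3 * t ^ 2 + 4 * e`; take `x = 2 * s + t` and `y = t`.
  obtain ⟨x, y, hxy⟩ := FiniteField.exists_root_sum_quadratic
    (f := Polynomial.C 1 * Polynomial.X ^ 2 + Polynomial.C 0 * Polynomial.X + Polynomial.C (4 * e))
    (g := Polynomial.C 3 * Polynomial.X ^ 2 + Polynomial.C 0 * Polynomial.X + Polynomial.C (0 : K))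
    (Polynomial.degree_quadratic one_ne_zero) (Polynomial.degree_quadratic h3) hodd
  simp only [Polynomial.eval_add, Polynomial.eval_mul, Polynomial.eval_C, Polynomial.eval_pow,
    Polynomial.eval_X] at hxy
  refine ⟨(x - y) / 2, y, ?_⟩
  field_simp
  linear_combination hxy

/-- In characteristic 2 the fiber of `0` is `{0, √e}`, yet another fiber cannot have exactly two
points, because the three roots sum to zero. Otherwise `m ≤ 3` divides a number prime to 6, so the
map would be injective, which a point on `s ^ 2 + s * t + t ^ 2 + e = 0` refutes. -/
theorem not_uniformFibers_depressed_cubic {m : ℕ} (h3 : (3 : K) ≠ 0) (hK : 2 < Nat.card K) {e : K}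
    (he : e ≠ 0) : ¬ UniformFibers m (fun s : K => s ^ 3 + e * s) := by
  intro h
  have h3' : ¬ 3 ∣ Nat.card K := by
    rw [← natCast_prime_eq_zero_iff Nat.prime_three]
    exact_mod_cast h3
  have hdvd := h.dvd_card
  by_cases h2 : (2 : K) = 0
  · obtain ⟨r, hr⟩ : ∃ r : K, r ^ 2 = e :=
      Finite.surjective_of_injective (injective_sq_of_two_eq_zero h2) e
    have hr0 : r ≠ 0 := by
      rintro rfl
      exact he (by simpa using hr.symm)
    have hm : m = 2 := by
      rw [← h 0, Set.ncard_eq_two]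
      refine ⟨0, r, hr0.symm, ?_⟩
      ext t
      simp only [Set.mem_ofPred_eq, Set.mem_insert_iff, Set.mem_singleton_iff]
      constructor
      · intro ht
        have : t * (t - r) ^ 2 = 0 := by linear_combination ht + t * hr - t ^ 2 * r * h2
        rcases mul_eq_zero.1 this with h0 | h0
        · exact Or.inl h0
        · exact Or.inr (sub_eq_zero.1 (pow_eq_zero_iff two_ne_zero |>.1 h0))
      · rintro (rfl | rfl)
        · rfl
        · linear_combination (-t) * hr + t ^ 3 * h2
    obtain ⟨s, hs⟩ : ∃ s : K, s ∉ ({0, r} : Set K) := by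
      by_contra! hall
      have := Set.ncard_le_ncard (s := Set.univ) (t := ({0, r} : Set K)) fun s _ => hall s
      rw [Set.ncard_univ] at this
      have := Set.ncard_insert_le 0 ({r} : Set K)
      rw [Set.ncard_singleton] at this
      omega
    simp only [Set.mem_insert_iff, Set.mem_singleton_iff, not_or] at hs
    have hs2 := h s
    rw [hm, Set.ncard_eq_two] at hs2
    obtain ⟨x, y, hxy, hset⟩ := hs2
    have hmem : ∀ t, t ^ 3 + e * t = s ^ 3 + e * s ↔ t = x ∨ t = y := by
      intro t
      simpa using congrArg (t ∈ ·) hset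
    obtain ⟨t, hts, ht⟩ : ∃ t, t ≠ s ∧ t ^ 3 + e * t = s ^ 3 + e * s := by
      by_cases hxs : x = s
      · exact ⟨y, fun hh => hxy (hxs.trans hh.symm), (hmem y).2 (Or.inr rfl)⟩
      · exact ⟨x, hxs, (hmem x).2 (Or.inl rfl)⟩
    have hq : t ^ 2 + s * t + s ^ 2 + e = 0 := by
      apply mul_left_cancel₀ (sub_ne_zero.2 hts)
      linear_combination ht
    have hthird : (s + t) ^ 3 + e * (s + t) = s ^ 3 + e * s := by
      linear_combination t * hq + (s ^ 2 * t + s * t ^ 2) * h2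
    have hcases : s + t = s ∨ s + t = t := by
      have h1 := (hmem s).1 rfl
      have h2' := (hmem t).1 ht
      have h3' := (hmem _).1 hthird
      grind
    rcases hcases with h0 | h0
    · have ht0 : t = 0 := by linear_combination h0
      subst ht0
      have : (s - r) ^ 2 = 0 := by linear_combination hq + hr - r * s * h2
      exact hs.2 (sub_eq_zero.1 (pow_eq_zero_iff two_ne_zero |>.1 this))
    · exact hs.1 (by linear_combination h0)
  · have hle : m ≤ 3 := by
      rw [← h 0]
      have hdeg : (Polynomial.C 1 * Polynomial.X ^ 3 + Polynomial.C 0 * Polynomial.X ^ 2 +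
          Polynomial.C e * Polynomial.X + Polynomial.C (0 : K)).natDegree = 3 :=
        Polynomial.natDegree_cubic one_ne_zero
      have := Polynomial.ncard_eval_eq_zero_le (p := Polynomial.C 1 * Polynomial.X ^ 3 +
        Polynomial.C 0 * Polynomial.X ^ 2 + Polynomial.C e * Polynomial.X + Polynomial.C (0 : K))
        (by rintro h0; rw [h0] at hdeg; simp at hdeg)
      rw [hdeg] at this
      simpa using this
    have h2' : ¬ 2 ∣ Nat.card K := by
      rw [← natCast_prime_eq_zero_iff Nat.prime_two]
      exact_mod_cast h2
    have hm1 : m = 1 := by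
      have : m ≠ 0 := by
        rintro rfl
        have := Nat.card_pos (α := K)
        have := Nat.eq_zero_of_zero_dvd hdvd
        omega
      have : m ≠ 2 := fun hh => h2' (hh ▸ hdvd)
      have : m ≠ 3 := fun hh => h3' (hh ▸ hdvd)
      omega
    have hinj := uniformFibers_one_iff.1 (hm1 ▸ h)
    obtain ⟨s, t, hst⟩ := exists_sq_add_mul_add_sq_add_eq_zero h2 e h3
    have heq : s = t := hinj (by
      simp only
      linear_combination (s - t) * hst)
    -- Now `s` is a double root of its fiber, and the remaining root is `-2 * s`.
    subst heq
    have hs : s = -2 * s := hinj (by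
      simp only
      linear_combination 3 * s * hst)
    have hs0 : s = 0 := by
      apply (mul_eq_zero.1 (show (3 : K) * s = 0 by linear_combination hs)).resolve_left h3
    subst hs0
    exact he (by simpa using hst)

theorem uniformFibers_cubic_iff {m : ℕ} (h3 : (3 : K) ≠ 0) (hK : 2 < Nat.card K) {k l n : K}
    (hk : k ≠ 0) :
    UniformFibers m (fun s : K => k * s ^ 3 + 3 * l * s ^ 2 + n * s) ↔
      m = 1 ∧ Nat.card K ≡ 2 [MOD 3] ∧ 3 * l ^ 2 = n * k := by
  -- The linear coefficient after dividing by `k` and completing the cube with the shift by `l / k`.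
  set e : K := n / k - 3 * (l / k) ^ 2 with he
  have hinj : Function.Injective fun x : K => k * x + (k * (l / k) ^ 3 * 2 - n * (l / k)) := by
    intro x y hxy
    exact mul_left_cancel₀ hk (add_right_cancel hxy)
  have hfun : (fun s : K => k * s ^ 3 + 3 * l * s ^ 2 + n * s) = fun s : K =>
      (fun x : K => k * x + (k * (l / k) ^ 3 * 2 - n * (l / k)))
        ((fun s : K => s ^ 3 + e * s) (Equiv.addRight (l / k) s)) := by
    funext s
    simp only [Equiv.coe_addRight, he]
    field_simp
    ring
  rw [hfun, uniformFibers_comp_iff (Equiv.addRight (l / k)) (g := fun s : K => s ^ 3 + e * s) hinj]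
  have hiff : e = 0 ↔ 3 * l ^ 2 = n * k := by
    rw [he, sub_eq_zero, div_pow, mul_div_assoc', div_eq_div_iff hk (pow_ne_zero 2 hk)]
    constructor
    · intro h
      apply mul_left_cancel₀ hk
      linear_combination -h
    · intro h
      linear_combination -k * h
  by_cases h0 : e = 0
  · have := hiff.1 h0
    simp only [h0, zero_mul, add_zero, uniformFibers_cube_iff h3, this, and_true]
  · rw [iff_false_left (not_uniformFibers_depressed_cubic h3 hK h0), ← hiff]
    tauto

end Cubic

/-! ### Counting along maps with fibers of size `q`. -/

theorem sum_ncard_fibers {S T : Type*} [Finite S] [Fintype T] (φ : S → T) :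
    ∑ z, (φ ⁻¹' {z}).ncard = Nat.card S := by
  classical
  have := Fintype.ofFinite S
  rw [Nat.card_eq_fintype_card, ← Finset.card_univ,
    Finset.card_eq_sum_card_fiberwise (f := φ) (t := Finset.univ) (by intro; simp)]
  refine Finset.sum_congr rfl fun z _ => ?_
  rw [← Set.ncard_coe_finset]
  congr 1
  ext
  simp

theorem ncard_preimage_of_fibers {S T : Type*} [Finite S] {φ : S → T} {q : ℕ}
    (hφ : ∀ z, (φ ⁻¹' {z}).ncard = q) (Z : Finset T) : (φ ⁻¹' (Z : Set T)).ncard = q * Z.card := by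
  classical
  have := Fintype.ofFinite S
  have hset : φ ⁻¹' (Z : Set T) = (Finset.univ.filter fun s => φ s ∈ Z : Finset S) := by
    ext
    simp
  rw [hset, Set.ncard_coe_finset,
    Finset.card_eq_sum_card_fiberwise (f := φ) (t := Z) (by intro; simp), mul_comm, ← smul_eq_mul,
    ← Finset.sum_const]
  refine Finset.sum_congr rfl fun z hz => ?_
  rw [← hφ z, ← Set.ncard_coe_finset]
  congr 1
  ext s
  simp only [Finset.coe_filter, Finset.mem_filter, Finset.mem_univ, true_and, Set.mem_ofPred_eq,
    Set.mem_preimage, Set.mem_singleton_iff, and_iff_right_iff_imp]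
  rintro rfl
  exact hz

/-- At most `q` fibers of size at most `q` must cover `q ^ 2` points, so both bounds are attained.
-/
theorem card_eq_and_fibers_eq {S T : Type*} [Finite S] [Finite T] {φ : S → T} {q : ℕ} (hq : 0 < q)
    (hS : Nat.card S = q ^ 2) (hT : Nat.card T ≤ q) (hφ : ∀ z, (φ ⁻¹' {z}).ncard ≤ q) :
    Nat.card T = q ∧ ∀ z, (φ ⁻¹' {z}).ncard = q := by
  have := Fintype.ofFinite T
  have hsum := sum_ncard_fibers φ
  have hle : ∑ z, (φ ⁻¹' {z}).ncard ≤ ∑ _z : T, q := Finset.sum_le_sum fun z _ => hφ z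
  have hconst : ∑ _z : T, q = Nat.card T * q := by simp
  have hcard : Nat.card T = q := by
    refine le_antisymm hT ?_
    rw [hsum, hS, hconst, sq] at hle
    exact Nat.le_of_mul_le_mul_right hle hq
  refine ⟨hcard, fun z => ?_⟩
  refine (Finset.sum_eq_sum_iff_of_le fun z _ => hφ z).1 ?_ z (Finset.mem_univ z)
  rw [hsum, hS, hconst, hcard, sq]

/-- If the fibers of `f` are those of `g` pulled back along a map all of whose fibers have the same
size `q = #T`, then `f` is `m`-to-1 exactly when the nonempty fibers of `g` have size `m`. -/
theorem isManyToOne_iff_uniformFibers {S S' T T' : Type*} [Finite S] [Finite S'] [Finite T] {q m : ℕ}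
    (hS : Nat.card S = q ^ 2) (hT : Nat.card T = q) {f : S → S'} {g : T → T'} {φ : S' → T'}
    (hφ : ∀ z, (φ ⁻¹' {z}).ncard = q)
    (hfg : ∀ y, (f ⁻¹' {y}).ncard = (g ⁻¹' {φ y}).ncard) (hm : 1 ≤ m) (hmq : m ≤ q) :
    IsManyToOne m f ↔ UniformFibers m g := by
  classical
  have := Fintype.ofFinite T
  let Z : Finset T' := (Finset.univ.image g).filter fun z => (g ⁻¹' {z}).ncard = m
  have hZ : ∀ z, z ∈ Z ↔ (g ⁻¹' {z}).ncard = m := by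
    intro z
    simp only [Z, Finset.mem_filter, Finset.mem_image, Finset.mem_univ, true_and,
      and_iff_right_iff_imp]
    intro h
    obtain ⟨s, hs⟩ := Set.nonempty_of_ncard_ne_zero (s := g ⁻¹' {z}) (by omega)
    exact ⟨s, hs⟩
  have hcount : (Finset.univ.filter fun s => g s ∈ Z).card = Z.card * m := by
    rw [Finset.card_eq_sum_card_fiberwise (f := g) (t := Z) (by intro; simp), ← smul_eq_mul,
      ← Finset.sum_const]
    refine Finset.sum_congr rfl fun z hz => ?_
    rw [← (hZ z).1 hz, ← Set.ncard_coe_finset]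
    congr 1
    ext s
    simp only [Finset.coe_filter, Finset.mem_filter, Finset.mem_univ, true_and, Set.mem_ofPred_eq,
      Set.mem_preimage, Set.mem_singleton_iff, and_iff_right_iff_imp]
    rintro rfl
    exact hz
  have huniv : (Finset.univ : Finset T).card = q := by
    rw [Finset.card_univ, ← Nat.card_eq_fintype_card, hT]
  have hpre := ncard_preimage_of_fibers hφ Z
  constructor
  · rintro ⟨-, -, Y, hYcard, hY⟩
    have hYle : Y.card ≤ q * Z.card := by
      rw [← hpre, ← Set.ncard_coe_finset]
      refine Set.ncard_le_ncard fun y hy => ?_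
      simp only [Set.mem_preimage, Finset.mem_coe, hZ, ← hfg]
      exact hY y hy
    have hle : Z.card * m ≤ q := by
      rw [← hcount, ← huniv]
      exact Finset.card_le_card (Finset.filter_subset _ _)
    have heq : Z.card * m = q := by
      -- If `Z.card * m ≤ q - 1`, then `(q * Z.card + 1) * m ≤ q * (q - 1) + m ≤ q ^ 2`, too few for
      -- `⌊q ^ 2 / m⌋` values; this is where `m ≤ q` enters.
      by_contra hne
      have hlt : Z.card * m + 1 ≤ q := by omega
      rw [hYcard, hS] at hYle
      have h1 : q ^ 2 < (q * Z.card + 1) * m := by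
        have := Nat.lt_mul_div_succ (q ^ 2) hm
        calc q ^ 2 < m * (q ^ 2 / m + 1) := this
          _ ≤ m * (q * Z.card + 1) := Nat.mul_le_mul_left _ (by omega)
          _ = _ := mul_comm _ _
      nlinarith
    have hall : (Finset.univ.filter fun s => g s ∈ Z) = Finset.univ :=
      Finset.eq_of_subset_of_card_le (Finset.filter_subset _ _) (by rw [hcount, heq, huniv])
    intro s
    have hs : s ∈ Finset.univ.filter fun s => g s ∈ Z := by
      rw [hall]
      exact Finset.mem_univ s
    exact (hZ _).1 (Finset.mem_filter.1 hs).2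
  · intro h
    have hall : (Finset.univ.filter fun s => g s ∈ Z) = Finset.univ :=
      Finset.filter_true_of_mem fun s _ => (hZ _).2 (h s)
    rw [hall, huniv] at hcount
    refine ⟨hm, ?_, (Set.toFinite (φ ⁻¹' (Z : Set T'))).toFinset, ?_, ?_⟩
    · rw [hS]
      nlinarith
    · rw [← Set.ncard_eq_toFinset_card, hpre, hS]
      refine (Nat.div_eq_of_eq_mul_left hm ?_).symm
      rw [mul_assoc, ← hcount, sq]
    · intro y hy
      rw [hfg, ← hZ]
      simpa using hy

theorem IsManyToOne.comp_equiv {S T T' : Type*} {m : ℕ} {f : S → T} (h : IsManyToOne m f)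
    (j : T ≃ T') : IsManyToOne m (fun s => j (f s)) := by
  obtain ⟨h1, h2, Y, hY, h⟩ := h
  refine ⟨h1, h2, Y.map j.toEmbedding, by rw [Finset.card_map, hY], ?_⟩
  intro y hy
  obtain ⟨x, hx, rfl⟩ := Finset.mem_map.1 hy
  rw [← h x hx]
  congr 1
  ext s
  simp

theorem isManyToOne_comp_equiv_iff {S T T' : Type*} {m : ℕ} (f : S → T) (j : T ≃ T') :
    IsManyToOne m (fun s => j (f s)) ↔ IsManyToOne m f :=
  ⟨fun h => by simpa using h.comp_equiv j.symm, fun h => h.comp_equiv j⟩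

/-! ### Reduction to a cubic over the fixed field of the conjugation. -/

section Semilinear

variable {F : Type*} [Field F] [Finite F] {q : ℕ}

theorem exists_ringHom_pow (hF : Nat.card F = q ^ 2) :
    ∃ σ : F →+* F, (∀ x, σ x = x ^ q) ∧ ∀ x, σ (σ x) = x := by
  have := Fintype.ofFinite F
  obtain ⟨p, hp, n, hpp, hn⟩ := FiniteField.card' F
  have := Fact.mk hpp
  rw [← Nat.card_eq_fintype_card, hF] at hn
  obtain ⟨k, -, hk⟩ := (Nat.dvd_prime_pow hpp).1 (hn ▸ dvd_pow_self q two_ne_zero)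
  refine ⟨iterateFrobenius F p k, fun x => by rw [iterateFrobenius_def, hk], fun x => ?_⟩
  rw [iterateFrobenius_def, iterateFrobenius_def, ← hk, ← pow_mul, ← sq, ← hF,
    Nat.card_eq_fintype_card, FiniteField.pow_card]

theorem ncard_semilinear_eq_le (hq : 2 ≤ q) {a : F} (ha : a ≠ 0) (b d : F) :
    ({x | a * x ^ q + b * x = d} : Set F).ncard ≤ q := by
  have hdeg : (Polynomial.C a * Polynomial.X ^ q +
      (Polynomial.C b * Polynomial.X - Polynomial.C d)).natDegree = q := by
    rw [Polynomial.natDegree_add_eq_left_of_natDegree_lt]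
    · exact Polynomial.natDegree_C_mul_X_pow q a ha
    · rw [Polynomial.natDegree_C_mul_X_pow q a ha]
      refine lt_of_le_of_lt (b := 1) ?_ (by omega)
      compute_degree
  have hne : (Polynomial.C a * Polynomial.X ^ q +
      (Polynomial.C b * Polynomial.X - Polynomial.C d)) ≠ 0 := by
    intro h
    rw [h, Polynomial.natDegree_zero] at hdeg
    omega
  have := Polynomial.ncard_eval_eq_zero_le hne
  rw [hdeg] at this
  refine le_trans (Set.ncard_le_ncard fun x hx => ?_) this
  simp only [Set.mem_ofPred_eq, Polynomial.eval_add, Polynomial.eval_mul, Polynomial.eval_C,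
    Polynomial.eval_pow, Polynomial.eval_X, Polynomial.eval_sub] at hx ⊢
  linear_combination hx

end Semilinear

/-- The cubic attached to `(a x ^ q + b x + c) ^ 3 + u x ^ q + v x` on the line of values of
`a x ^ q + b x`; primes denote conjugates. -/
theorem semilinear_cubic_identity {F : Type*} [Field F] {a a' b b' c c' u u' v v' t A A' B B' : F}
    (ha : a ≠ 0) (hb : b ≠ 0) (hb' : b' ≠ 0) (hab : a * a' = b * b') (hA : A = b * u - a * v)
    (hA' : A' = b' * u' - a' * v') (hB : B = a * u' - b * v') (hB' : B' = a' * u - b' * v)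
    (hA0 : A ≠ 0) (hB0 : B ≠ 0) :
    a * ((u' * (a' / b * t) + a' * ((a' / b * t + c') ^ 3 - c' ^ 3)) / A') +
        b * ((u * t + a * ((t + c) ^ 3 - c ^ 3)) / A) - t =
      b * b' / (B * B') *
        (((a' / b) ^ 2 * B' + B) * t ^ 3 + 3 * (a' / b * c' * B' + c * B) * t ^ 2 +
          (3 * (c' ^ 2 * B' + c ^ 2 * B) - (v * v' - u * u')) * t) := by
  -- Eliminating `a', B', A', u, u'` in favor of `a, b, b', A, B, v, v'` leaves an identity of
  -- rational functions.
  obtain rfl : a' = b * b' / a := by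
    field_simp
    linear_combination hab
  obtain rfl : B' = b' / a * A := by
    rw [hB', hA]
    field_simp
  obtain rfl : A' = b' / a * B := by
    rw [hA', hB]
    field_simp
  obtain rfl : u = (A + a * v) / b := by
    field_simp
    linear_combination -hA
  obtain rfl : u' = (B + b * v') / a := by
    field_simp
    linear_combination -hB
  field_simp
  ring

/-- Equal norms of `a` and `b` make `σ B` a nonzero multiple of `b u - a v` when `a, b ≠ 0`. This
yields `B ≠ 0` and the equality of the norms of `A` and `B`. -/
theorem mul_conj_eq {F : Type*} [Field F] {σ : F →+* F} (hσσ : ∀ x, σ (σ x) = x) {a b u v B : F}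
    (hab : a * σ a = b * σ b) (hB : B = a * σ u - b * σ v) :
    a * σ B = σ b * (b * u - a * v) := by
  rw [hB]
  simp only [map_sub, map_mul, hσσ]
  linear_combination u * hab

theorem conj_ne_zero_of_ne {F : Type*} [Field F] {σ : F →+* F} (hσσ : ∀ x, σ (σ x) = x)
    {a b u v B : F} (hb : b ≠ 0) (hab : a * σ a = b * σ b) (huv : b * u - a * v ≠ 0)
    (hB : B = a * σ u - b * σ v) : B ≠ 0 := by
  rintro rfl
  have h := mul_conj_eq hσσ hab hB
  rw [map_zero, mul_zero] at h
  exact mul_ne_zero (by simpa using hb) huv h.symm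

theorem exists_cubic_isManyToOne_iff {F : Type*} [Field F] [Finite F] {q : ℕ} (hq : 2 ≤ q)
    (hF : Nat.card F = q ^ 2) {σ : F →+* F} (hσ : ∀ x, σ x = x ^ q) (hσσ : ∀ x, σ (σ x) = x)
    {a b u v B : F} (c : F) (ha : a ≠ 0) (hb : b ≠ 0) (hab : a * σ a = b * σ b)
    (huv : b * u - a * v ≠ 0) (hB : B = a * σ u - b * σ v) :
    ∃ (K : Subfield F) (w : F) (k l n : K), Nat.card K = q ∧ (∀ x, x ∈ K ↔ σ x = x) ∧ w ≠ 0 ∧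
      σ w = σ a / b * w ∧ (k : F) = ((σ a / b) ^ 2 * σ B + B) * w ^ 2 ∧
      (l : F) = (σ a / b * σ c * σ B + c * B) * w ∧
      (n : F) = 3 * (σ c ^ 2 * σ B + c ^ 2 * B) - (v * σ v - u * σ u) ∧
      ∀ m, 1 ≤ m → m ≤ q →
        (IsManyToOne m (fun x => (a * σ x + b * x + c) ^ 3 + u * σ x + v * x) ↔
          UniformFibers m (fun s : K => k * s ^ 3 + 3 * l * s ^ 2 + n * s)) := by
  have hb' : σ b ≠ 0 := by simpa using hb
  have ha' : σ a ≠ 0 := by simpa using ha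
  set A := b * u - a * v with hA
  have hBA : σ B = σ b / a * A := by
    field_simp
    linear_combination mul_conj_eq hσσ hab hB
  have hB0 : B ≠ 0 := conj_ne_zero_of_ne hσσ hb hab huv hB
  have hB0' : σ B ≠ 0 := by simpa using hB0
  let K : Subfield F := σ.eqLocusField (RingHom.id F)
  have hK : ∀ x, x ∈ K ↔ σ x = x := fun x => Iff.rfl
  have hKle : Nat.card K ≤ q := by
    have := ncard_semilinear_eq_le hq (one_ne_zero (α := F)) (-1) 0
    refine le_trans (le_of_eq ?_) this
    rw [← Nat.card_coe_set_eq]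
    refine Nat.card_congr (Equiv.subtypeEquivRight fun x => ?_)
    rw [hK, hσ, Set.mem_ofPred_eq, one_mul, neg_one_mul, ← sub_eq_add_neg, sub_eq_zero]
  let Λ : F → F := fun x => a * σ x + b * x
  have hΛ : ∀ x, σ (Λ x) = σ a / b * Λ x := by
    intro x
    simp only [Λ, map_add, map_mul, hσσ]
    field_simp
    linear_combination (-σ x) * hab
  have hΛfib : ∀ d, ({x | Λ x = d} : Set F).ncard ≤ q := by
    intro d
    simp only [Λ, hσ]
    exact ncard_semilinear_eq_le hq ha b d
  -- Otherwise `Λ` would vanish on all `q ^ 2` elements, but its kernel has at most `q`.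
  obtain ⟨w, hw, hw0⟩ : ∃ w, σ w = σ a / b * w ∧ w ≠ 0 := by
    by_contra! h
    have h0 := hΛfib 0
    have : ({x | Λ x = 0} : Set F) = Set.univ := by
      ext x
      simp [h _ (hΛ x)]
    rw [this, Set.ncard_univ, hF] at h0
    nlinarith
  have hρ : σ (σ a / b) * (σ a / b) = 1 := by
    rw [map_div₀, hσσ]
    field_simp
    linear_combination hab
  have hNK : σ (B * σ B / (b * σ b)) = B * σ B / (b * σ b) := by
    simp only [map_div₀, map_mul, hσσ]
    ring
  have hN0 : B * σ B / (b * σ b) ≠ 0 := div_ne_zero (mul_ne_zero hB0 hB0') (mul_ne_zero hb hb')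
  have hdiv : ∀ x, σ (Λ x / w) = Λ x / w := by
    intro x
    rw [map_div₀, hΛ, hw]
    field_simp
  have hk : σ (((σ a / b) ^ 2 * σ B + B) * w ^ 2) = ((σ a / b) ^ 2 * σ B + B) * w ^ 2 := by
    rw [map_mul, map_add, map_mul, map_pow, map_pow, hσσ, hw]
    linear_combination B * w ^ 2 * (σ (σ a / b) * (σ a / b) + 1) * hρ
  have hl : σ ((σ a / b * σ c * σ B + c * B) * w) = (σ a / b * σ c * σ B + c * B) * w := by
    rw [map_mul, map_add, map_mul, map_mul, map_mul, hσσ, hσσ, hw]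
    linear_combination c * B * w * hρ
  have hn : σ (3 * (σ c ^ 2 * σ B + c ^ 2 * B) - (v * σ v - u * σ u)) =
      3 * (σ c ^ 2 * σ B + c ^ 2 * B) - (v * σ v - u * σ u) := by
    simp only [map_sub, map_mul, map_add, map_pow, hσσ, map_ofNat]
    ring
  -- The part of the equation for `s` that depends on `y`; the norm quotient clears the denominator
  -- in `semilinear_cubic_identity` and lies in `K`.
  let φ : F → K := fun y =>
    ⟨B * σ B / (b * σ b) * (Λ (a * (y - c ^ 3) / A) / w), by rw [hK, map_mul, hNK, hdiv]⟩
  have hφ := card_eq_and_fibers_eq (φ := φ) (by omega) hF hKle (fun z => by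
    refine le_trans (Set.ncard_le_ncard_of_injOn (fun y => a * (y - c ^ 3) / A)
      (t := {x | Λ x = z * w / (B * σ B / (b * σ b))}) ?_ ?_) (hΛfib _)
    · rintro y rfl
      simp only [Set.mem_ofPred_eq, φ]
      rw [eq_div_iff hN0, mul_assoc, div_mul_cancel₀ _ hw0, mul_comm]
    · intro x _ y _ hxy
      simpa [div_left_inj' huv, ha] using hxy)
  refine ⟨K, w, ⟨_, hk⟩, ⟨_, hl⟩, ⟨_, hn⟩, hφ.1, hK, hw0, hw, rfl, rfl, rfl, fun m hm hmq => ?_⟩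
  refine isManyToOne_iff_uniformFibers hF hφ.1 hφ.2 (fun y => ?_) hm hmq
  have hsub : ∀ x y, Λ (x - y) = Λ x - Λ y := by
    intro x y
    simp only [Λ, map_sub]
    ring
  have hg : ∀ s : F, σ s = s → ((((σ a / b) ^ 2 * σ B + B) * w ^ 2) * s ^ 3 +
      3 * ((σ a / b * σ c * σ B + c * B) * w) * s ^ 2 +
      (3 * (σ c ^ 2 * σ B + c ^ 2 * B) - (v * σ v - u * σ u)) * s =
        B * σ B / (b * σ b) * (Λ (a * (y - c ^ 3) / A) / w) ↔
      Λ ((u * (w * s) + a * (w * s + c) ^ 3 - a * y) / A) = w * s) := by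
    intro s hs
    have hid := semilinear_cubic_identity (c := c) (c' := σ c) (t := w * s) (v := v) (v' := σ v)
      (u := u) (u' := σ u) (A' := σ A) ha hb hb' hab hA
      (by rw [hA]; simp) hB (B' := σ B) (by rw [hB]; simp [hσσ]) huv hB0
    have hLeq : Λ ((u * (w * s) + a * ((w * s + c) ^ 3 - c ^ 3)) / A) - w * s =
        b * σ b / (B * σ B) *
        (((σ a / b) ^ 2 * σ B + B) * (w * s) ^ 3 + 3 * (σ a / b * σ c * σ B + c * B) * (w * s) ^ 2 +
          (3 * (σ c ^ 2 * σ B + c ^ 2 * B) - (v * σ v - u * σ u)) * (w * s)) := by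
      rw [← hid]
      simp only [Λ, map_div₀, map_add, map_mul, map_sub, map_pow, hs, hw, mul_assoc]
    have hsplit : (u * (w * s) + a * (w * s + c) ^ 3 - a * y) / A =
        (u * (w * s) + a * ((w * s + c) ^ 3 - c ^ 3)) / A - a * (y - c ^ 3) / A := by
      ring
    rw [hsplit, hsub, sub_eq_iff_eq_add, ← sub_eq_iff_eq_add', hLeq]
    generalize Λ (a * (y - c ^ 3) / A) = z
    generalize (σ a / b) ^ 2 * σ B + B = e₃
    generalize σ a / b * σ c * σ B + c * B = e₂
    generalize 3 * (σ c ^ 2 * σ B + c ^ 2 * B) - (v * σ v - u * σ u) = e₁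
    field_simp
  -- In `u * Λ x - a * (u * σ x + v * x)` the terms in `σ x` cancel, leaving `(b * u - a * v) * x`.
  have hrec : ∀ x, (a * σ x + b * x + c) ^ 3 + u * σ x + v * x = y →
      (u * Λ x + a * (Λ x + c) ^ 3 - a * y) / A = x := by
    rintro x rfl
    rw [div_eq_iff huv, hA]
    simp only [Λ]
    ring
  refine Set.ncard_congr (fun x _ => ⟨Λ x / w, hdiv x⟩) ?_ ?_ ?_
  · intro x hx
    refine Subtype.ext ((hg (Λ x / w) (hdiv x)).2 ?_)
    rw [mul_div_cancel₀ _ hw0, hrec x hx]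
  · intro x y hx hy hxy
    have : Λ x = Λ y := (div_left_inj' hw0).1 (congrArg Subtype.val hxy)
    rw [← hrec x hx, ← hrec y hy, this]
  · rintro ⟨s, hs⟩ hs'
    have hs'' := (hg s hs).1 (congrArg Subtype.val hs')
    obtain ⟨x, hx⟩ : ∃ x, (u * (w * s) + a * (w * s + c) ^ 3 - a * y) / A = x := ⟨_, rfl⟩
    rw [hx] at hs''
    refine ⟨x, ?_, ?_⟩
    · rw [div_eq_iff huv, ← hs'', hA] at hx
      apply mul_left_cancel₀ ha
      simp only [Λ] at hx
      linear_combination hx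
    · refine Subtype.ext ?_
      simp only
      rw [hs'', mul_div_cancel_left₀ _ hw0]

/-! ### Matching the invariants of the cubic with the seven cases. -/

/-- Solutions `r` correspond to square roots `z = α * w * r / b` of `α * γ`, and `σ r = r` means `z
^ (q - 1) = a / b`. -/
theorem exists_root_iff_pow_eq {F : Type*} [Field F] [Finite F] {q : ℕ} (hF : Nat.card F = q ^ 2)
    (hodd : q % 2 = 1) (hq : 2 ≤ q) {σ : F →+* F} (hσ : ∀ x, σ x = x ^ q)
    {a b w k α γ : F} (ha : a ≠ 0) (hb : b ≠ 0) (hab : a * σ a = b * σ b)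
    (hw0 : w ≠ 0) (hw : σ w = σ a / b * w) (hα : b ^ 2 * σ α = a ^ 2 * α) (hα0 : α ≠ 0)
    (hk : k * b ^ 2 = α * w ^ 2) :
    (∃ r, σ r = r ∧ r ≠ 0 ∧ k * r ^ 2 = γ) ↔ (α * γ) ^ ((q - 1) / 2) = a * b⁻¹ := by
  have := Fintype.ofFinite F
  have hb' : σ b ≠ 0 := by simpa using hb
  have ha' : σ a ≠ 0 := by simpa using ha
  have hhalf : 2 * ((q - 1) / 2) = q - 1 := by omega
  have hpow : ∀ x, x * x ^ (q - 1) = σ x := by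
    intro x
    rw [hσ, ← pow_succ', Nat.sub_add_cancel (by omega)]
  have hα' : σ α = a ^ 2 * α / b ^ 2 := by
    rw [eq_div_iff (pow_ne_zero 2 hb), ← hα, mul_comm]
  constructor
  · rintro ⟨r, hr, hr0, rfl⟩
    have hsq : α * (k * r ^ 2) = (α * w * r / b) ^ 2 := by
      field_simp
      linear_combination hk
    have hz0 : α * w * r / b ≠ 0 := div_ne_zero (mul_ne_zero (mul_ne_zero hα0 hw0) hr0) hb
    rw [hsq, ← pow_mul, hhalf]
    apply mul_left_cancel₀ hz0
    rw [hpow, map_div₀, map_mul, map_mul, hr, hw, hα']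
    field_simp
    linear_combination hab
  · intro h
    have hab0 : a * b⁻¹ ≠ 0 := mul_ne_zero ha (inv_ne_zero hb)
    have hne : α * γ ≠ 0 := by
      intro h0
      rw [h0, zero_pow (by omega)] at h
      exact hab0 h.symm
    have hnorm : (a * b⁻¹) ^ (q + 1) = 1 := by
      rw [pow_succ, ← hσ, map_mul, map_inv₀]
      field_simp
      linear_combination hab
    have hchar : ringChar F ≠ 2 := by
      intro h2
      have := FiniteField.even_card_of_char_two h2
      rw [← Nat.card_eq_fintype_card, hF, Nat.pow_mod, hodd] at this
      omega
    -- Euler's criterion: the exponent `(q ^ 2 - 1) / 2` is `(q - 1) / 2 * (q + 1)`, and `a / b` has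
    -- norm 1.
    have hsquare : IsSquare (α * γ) := by
      rw [FiniteField.isSquare_iff hchar hne, ← hnorm, ← h, ← pow_mul, ← Nat.card_eq_fintype_card,
        hF]
      congr 1
      obtain ⟨j, rfl⟩ : ∃ j, q = 2 * j + 1 := ⟨q / 2, by omega⟩
      have : (2 * j + 1) ^ 2 = 2 * (2 * j ^ 2 + 2 * j) + 1 := by ring
      rw [this, Nat.mul_add_div two_pos, Nat.add_sub_cancel, Nat.mul_div_cancel_left _ two_pos]
      ring
    obtain ⟨z, hz⟩ := hsquare
    have hz0 : z ≠ 0 := by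
      rintro rfl
      exact hne (by simpa using hz)
    have hσz : σ z = z * (a * b⁻¹) := by
      rw [← hpow, ← h, hz, ← sq, ← pow_mul, hhalf]
    refine ⟨z * b / (α * w), ?_, div_ne_zero (mul_ne_zero hz0 hb) (mul_ne_zero hα0 hw0), ?_⟩
    · rw [map_div₀, map_mul, map_mul, hw, hα', hσz]
      field_simp
      linear_combination -hab
    · field_simp
      linear_combination z ^ 2 * hk - α * w ^ 2 * hz

theorem isManyToOne_iff_sevenCases {F : Type*} [Field F] [Finite F] {q : ℕ} (hq : 3 ≤ q)
    (hF : Nat.card F = q ^ 2) {σ : F →+* F} (hσ : ∀ x, σ x = x ^ q) (hσσ : ∀ x, σ (σ x) = x)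
    {a b c u v B α β γ δ : F} (ha : a ≠ 0) (hb : b ≠ 0) (hab : a * σ a = b * σ b)
    (huv : b * u - a * v ≠ 0) (hB : B = a * σ u - b * σ v)
    (hα : α = σ a ^ 2 * σ B + b ^ 2 * B) (hβ : β = 3 * (σ a * c - b * σ c))
    (hγ : γ = v * σ v - u * σ u) (hδ : δ = β ^ 2 * B - σ a ^ 2 * γ) {m : ℕ} (hm : 1 ≤ m)
    (hmq : m ≤ q) :
    IsManyToOne m (fun x => (a * σ x + b * x + c) ^ 3 + u * σ x + v * x) ↔
      SevenCases q m a b B α β γ δ := by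
  have hb' : σ b ≠ 0 := by simpa using hb
  have ha' : σ a ≠ 0 := by simpa using ha
  have hB0 : B ≠ 0 := conj_ne_zero_of_ne hσσ hb hab huv hB
  obtain ⟨K, w, k, l, n, hcard, hK, hw0, hw, hk, hl, hn, hiff⟩ :=
    exists_cubic_isManyToOne_iff (by omega) hF hσ hσσ c ha hb hab huv hB
  rw [hiff m hm hmq]
  have h2 : (2 : K) = 0 ↔ 2 ∣ q := by
    rw [← hcard, ← natCast_prime_eq_zero_iff Nat.prime_two, Nat.cast_ofNat]
  have h3 : (3 : K) = 0 ↔ 3 ∣ q := by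
    rw [← hcard, ← natCast_prime_eq_zero_iff Nat.prime_three, Nat.cast_ofNat]
  have hcoe2 : (2 : K) = 0 ↔ (2 : F) = 0 := by
    rw [← Subtype.coe_inj]
    rfl
  have hcoe3 : (3 : K) = 0 ↔ (3 : F) = 0 := by
    rw [← Subtype.coe_inj]
    rfl
  have hkα : (k : F) * b ^ 2 = α * w ^ 2 := by
    rw [hk, hα]
    field_simp
  have hk0 : k = 0 ↔ α = 0 := by
    rw [← Subtype.coe_inj, ZeroMemClass.coe_zero]
    constructor
    · intro h
      rw [h, zero_mul] at hkα
      exact (mul_eq_zero.1 hkα.symm).resolve_right (pow_ne_zero 2 hw0)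
    · intro h
      rw [h, zero_mul] at hkα
      exact (mul_eq_zero.1 hkα).resolve_right (pow_ne_zero 2 hb)
  rw [← hγ] at hn
  by_cases hα0 : α = 0
  · have hB' : σ a ^ 2 * σ B = -(b ^ 2 * B) := by linear_combination hα0 - hα
    have hlβ : σ a * (3 * l) = B * β * w := by
      rw [hl, hβ]
      field_simp
      linear_combination 3 * σ c * hB'
    have hl0 : (3 * l = 0) ↔ β = 0 := by
      rw [← Subtype.coe_inj]
      change (3 * l : F) = 0 ↔ _
      rw [← mul_right_inj' ha', hlβ, mul_zero, mul_eq_zero, mul_eq_zero]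
      simp [hB0, hw0]
    rw [hk0.2 hα0]
    by_cases hβ0 : β = 0
    · have hnγ : (n : F) = -γ := by
        rw [hn, sub_eq_neg_self]
        rw [hβ] at hβ0
        rcases mul_eq_zero.1 hβ0 with h | h
        · rw [h, zero_mul]
        · apply mul_left_cancel₀ (pow_ne_zero 2 hb)
          linear_combination 3 * c ^ 2 * (hα0 - hα) - 3 * σ B * (σ a * c + b * σ c) * h
      rw [hl0.2 hβ0]
      simp only [zero_mul, zero_add]
      by_cases hγ0 : γ = 0
      · have hn0 : n = 0 := Subtype.ext (by simpa [hγ0] using hnγ)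
        simp only [hn0, zero_mul]
        rw [uniformFibers_const_iff, hcard]
        simp [SevenCases, hα0, hβ0, hγ0]
      · have hn0 : n ≠ 0 := by
          rintro rfl
          exact hγ0 (by simpa using hnγ)
        rw [uniformFibers_linear_iff hn0]
        simp [SevenCases, hα0, hβ0, hγ0]
    · have hl0' := hl0.not.2 hβ0
      simp only [zero_mul, zero_add]
      by_cases h2q : 2 ∣ q
      · have h20 := hcoe2.1 (h2.2 h2q)
        -- Holds only modulo 2, after removing `σ B` by means of `α = 0`.
        have hnδ : σ a ^ 2 * n = δ := by
          rw [hn, hδ, hβ]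
          linear_combination 3 * σ c ^ 2 * hB' +
            (-3 * (σ a * c) ^ 2 * B - 6 * b ^ 2 * B * σ c ^ 2 + 9 * B * σ a * b * c * σ c) * h20
        have hn0 : n = 0 ↔ δ = 0 := by
          rw [← hnδ]
          simp [ha]
        by_cases hδ0 : δ = 0
        · simp only [hn0.2 hδ0, zero_mul, add_zero]
          rw [uniformFibers_quadratic_even_zero_iff (h2.2 h2q) hl0']
          simp [SevenCases, hα0, hβ0, hδ0, h2q]
        · rw [uniformFibers_quadratic_even_iff (h2.2 h2q) hl0' (hn0.not.2 hδ0)]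
          simp [SevenCases, hα0, hβ0, hδ0, h2q]
      · rw [iff_false_left (not_uniformFibers_quadratic (h2.not.2 h2q) hl0')]
        simp [SevenCases, hα0, hβ0, h2q]
  · have hk0' := hk0.not.2 hα0
    by_cases h3q : 3 ∣ q
    · have h30 := h3.2 h3q
      have hnγ : (n : F) = -γ := by
        rw [hn, hcoe3.1 h30]
        ring
      have hmod : ¬ q ≡ 2 [MOD 3] := by
        unfold Nat.ModEq
        omega
      have hβ0 : β = 0 := by rw [hβ, hcoe3.1 h30, zero_mul]
      have h2q : ¬ 2 ∣ q := by
        rw [← h2]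
        intro h
        exact one_ne_zero (α := K) (by linear_combination h30 - h)
      have hroot : (∃ r : K, r ≠ 0 ∧ k * r ^ 2 + n = 0) ↔
          (α * γ) ^ ((q - 1) / 2) = a * b⁻¹ := by
        rw [← exists_root_iff_pow_eq hF (by omega) (by omega) hσ ha hb hab hw0 hw ?_ hα0 hkα]
        · constructor
          · rintro ⟨r, hr0, hr⟩
            refine ⟨r, (hK _).1 r.2, by simpa using hr0, ?_⟩
            have : (k * r ^ 2 + n : F) = 0 := congrArg Subtype.val hr
            linear_combination this - hnγ
          · rintro ⟨r, hr, hr0, hrk⟩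
            refine ⟨⟨r, (hK _).2 hr⟩, fun h => hr0 (congrArg Subtype.val h), Subtype.ext ?_⟩
            change (k * r ^ 2 + n : F) = 0
            linear_combination hrk + hnγ
        · rw [hα]
          simp only [map_add, map_mul, map_pow, hσσ]
          linear_combination -σ B * (a * σ a + b * σ b) * hab
      rw [h30]
      simp only [zero_mul, add_zero]
      by_cases hr : ∃ r : K, r ≠ 0 ∧ k * r ^ 2 + n = 0
      · rw [uniformFibers_additive_cubic_iff_three h30 hk0' hr]
        simp [SevenCases, hα0, hmod, hroot.1 hr, h3q]
      · rw [uniformFibers_additive_cubic_iff_one h30 hr]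
        simp [SevenCases, hα0, hmod, hroot.not.1 hr, h3q]
    · have h30 := h3.not.2 h3q
      have h30' := hcoe3.not.1 h30
      rw [uniformFibers_cubic_iff h30 (by omega) hk0', hcard]
      have hdisc : 3 * l ^ 2 = n * k ↔ β ^ 2 * B ^ (q + 1) = 3 * α * γ := by
        rw [← Subtype.coe_inj, pow_succ B q, ← hσ]
        change (3 * (l : F) ^ 2 = n * k) ↔ _
        -- The discriminant conditions agree up to the factors `3 * b ^ 2` and `w ^ 2`, which are
        -- nonzero away from characteristic 3.
        have key : 3 * b ^ 2 * (3 * (l : F) ^ 2 - n * k) =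
            w ^ 2 * (3 * α * γ - β ^ 2 * (σ B * B)) := by
          rw [hl, hn, hk, hβ, hα]
          field_simp
          ring
        rw [← sub_eq_zero, ← sub_eq_zero (b := 3 * α * γ),
          ← mul_right_inj' (mul_ne_zero h30' (pow_ne_zero 2 hb)), key, mul_zero, mul_eq_zero,
          or_iff_right (pow_ne_zero 2 hw0), ← neg_eq_zero, neg_sub]
      rw [hdisc]
      simp [SevenCases, hα0, h3q]

theorem mainTheorem7 {F : Type*} [Field F] [Finite F] (q : ℕ) (hF : Nat.card F = q ^ 2)
    (hq : 7 ≤ q) (a b c u v A B β γ α₁ δ₁ α₂ δ₂ : F)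
    (hab : a ^ (q + 1) = b ^ (q + 1)) (hav : a * v ≠ b * u)
    (hA : A = b * u - a * v) (hB : B = a * u ^ q - b * v ^ q)
    (hβ : β = 3 * (a ^ q * c - b * c ^ q))
    (hγ : γ = v ^ (q + 1) - u ^ (q + 1))
    (hα₁ : α₁ = a ^ (2 * q) * B ^ q + b ^ 2 * B)
    (hδ₁ : δ₁ = β ^ 2 * B - a ^ (2 * q) * γ)
    (hα₂ : α₂ = a ^ (2 * q) * A ^ q + b ^ 2 * A)
    (hδ₂ : δ₂ = β ^ 2 * A - a ^ (2 * q) * γ)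
    (m : ℕ) (hm1 : 1 ≤ m) (hmq : m ≤ q) :
    (IsManyToOnePoly m (fPoly q 3 a b c u v) ↔ SevenCases q m a b B α₁ β γ δ₁) ∧
    (IsManyToOnePoly m (fPoly q (3 * q) a b c u v) ↔ SevenCases q m a b B α₂ β γ δ₂) := by
  obtain ⟨σ, hσ, hσσ⟩ := exists_ringHom_pow hF
  have ha : a ≠ 0 := by
    rintro rfl
    rw [zero_pow (by omega), eq_comm, pow_eq_zero_iff (by omega)] at hab
    exact hav (by rw [hab, zero_mul, zero_mul])
  have hb : b ≠ 0 := by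
    rintro rfl
    rw [zero_pow (by omega), pow_eq_zero_iff (by omega)] at hab
    exact ha hab
  simp only [pow_succ _ q, mul_comm 2 q, pow_mul, ← hσ] at hab hB hβ hγ hα₁ hδ₁ hα₂ hδ₂
  have hab' : a * σ a = b * σ b := by linear_combination hab
  have huv : b * u - a * v ≠ 0 := sub_ne_zero.2 hav.symm
  constructor
  · rw [← isManyToOne_iff_sevenCases (by omega) hF hσ hσσ (c := c) ha hb hab' huv hB hα₁ hβ
      (by linear_combination hγ) hδ₁ hm1 hmq]
    simp [IsManyToOnePoly, fPoly, hσ]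
  · have hNAB : B ^ (q + 1) = (-A) ^ (q + 1) := by
      have h1 := mul_conj_eq hσσ hab' hB
      have h2 := congrArg σ h1
      rw [map_mul, map_mul, hσσ, hσσ, ← hA] at h2
      rw [← hA] at h1
      rw [pow_succ, pow_succ, ← hσ, ← hσ, map_neg]
      apply mul_left_cancel₀ (mul_ne_zero hb (show σ b ≠ 0 by simpa using hb))
      linear_combination -σ B * B * hab' + σ a * B * h1 + σ b * A * h2
    have hB' : b * σ v - a * σ u ≠ 0 := by
      rw [← neg_ne_zero, neg_sub, ← hB]
      exact conj_ne_zero_of_ne hσσ hb hab' huv hB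
    -- Replacing `u, v` by `σ v, σ u` turns `B` into `-A` and negates `γ`; the cases only see `α *
    -- γ`, the norm of `B`, and vanishing of `α, γ, δ`.
    have hcases : SevenCases q m a b B α₂ β γ δ₂ ↔
        SevenCases q m a b (-A) (-α₂) β (-γ) (-δ₂) := by
      simp [SevenCases, hNAB]
    rw [hcases, ← isManyToOne_iff_sevenCases (u := σ v) (v := σ u) (by omega) hF hσ hσσ (c := c) ha
      hb hab' hB' (by rw [hσσ, hσσ, hA]; ring)
      (by rw [hα₂, map_neg]; ring) hβ (by rw [hσσ, hσσ, hγ]; ring) (by rw [hδ₂]; ring) hm1 hmq]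
    let e : F ≃ F := ⟨σ, σ, hσσ, hσσ⟩
    rw [IsManyToOnePoly, ← isManyToOne_comp_equiv_iff _ e]
    have hfun : (fun x => e ((fPoly q (3 * q) a b c u v).eval x)) =
        fun x => (a * σ x + b * x + c) ^ 3 + σ v * σ x + σ u * x := by
      funext x
      simp only [fPoly, pow_mul, ← hσ, e, Equiv.coe_fn_mk, Polynomial.eval_add, Polynomial.eval_mul,
        Polynomial.eval_C, Polynomial.eval_pow, Polynomial.eval_X]
      simp only [map_add, map_mul, map_pow, hσσ]
      ring
    rw [hfun]
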